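/- Let $X$ be a compact metrizable space and let the abelian group $T$ act on $X$ by homeomorphisms $x\mapsto t\cdot x$ such that $(X,T)$ is minimal (every orbit is dense). Let $\pi:X\to X_{max}$ be the maximal equicontinuous factor of $(X,T)$, where $X_{max}$ carries its structure of a compact abelian topological group, written additively, on which $T$ acts by translations ($t\cdot\xi=t\cdot 0+\xi$). Let $E$ be the Ellis semigroup of $(X,T)$, that is, the closure of $\{x\mapsto t\cdot x : t\in T\}$ in $X^X$ for the topology of pointwise convergence, with composition as product. Let $e\in E$ be a minimal idempotent (an idempotent in the smallest two-sided ideal of $E$), let $\mathcal H_e=eEe$ be the structure group, and let $K_e\subset\mathcal H_e$ be the subgroup of those $h$ with $\pi(h(x))=\pi(x)$ for all $x\in X$. For $f\in K_e$ let $$\mathrm{supp}(f)=\{\xi\in X_{max} : f(x)\neq x \text{ for some } x\in e(\pi^{-1}(\xi))\}.$$ Suppose that there are $f\in K_e$ with $f\neq e$ and an uncountable set $A\subset X_{max}$ such that $$(\mathrm{supp}(f)+a)\cap(\mathrm{supp}(f)+b)=\emptyset\qquad\text{for all } a\neq b \text{ in } A.$$ Then $$2^{\mathrm{card}(A)}\le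 \mathrm{card}(\mathcal H_e)\le 2^{\mathfrak c},$$ where $\mathfrak c$ is the cardinality of the continuum. Consequently $\mathrm{card}(\mathcal H_e)=2^{\mathfrak c}$ whenever $\mathrm{card}(A)=\mathfrak c$; in particular, if the continuum hypothesis holds, then $\mathrm{card}(\mathcal H_e)=2^{\mathfrak c}$ for every uncountable $A$ as above. -/

import Mathlib

open Set Cardinal

universe u v

section EllisSemigroup

variable (T : Type v) (X : Type u) [TopologicalSpace X] [Group T] [MulAction T X]

/-- The Ellis (enveloping) semigroup of `(X, T)`: the closure of `{x ↦ t • x : t ∈ T}` in the set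
`X → X` of all self-maps with the topology of pointwise convergence (the product topology). The
product is composition. -/
def ellisSemigroup : Set (X → X) :=
  closure (range fun (t : T) (x : X) => t • x)

variable {X} in
/-- Non-empty two-sided (bilateral) ideals of the Ellis semigroup. -/
structure IsBilateralIdeal (I : Set (X → X)) : Prop where
  subset : I ⊆ ellisSemigroup T X
  nonempty : I.Nonempty
  comp_left : ∀ f ∈ ellisSemigroup T X, ∀ g ∈ I, f ∘ g ∈ I
  comp_right : ∀ f ∈ ellisSemigroup T X, ∀ g ∈ I, g ∘ f ∈ I

/-- The kernel of the Ellis semigroup: its smallest non-empty bilateral ideal. -/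
def ellisKernel : Set (X → X) :=
  {f | f ∈ ellisSemigroup T X ∧ ∀ I : Set (X → X), IsBilateralIdeal T I → f ∈ I}

variable {X}

/-- Minimal idempotents: the idempotents in the kernel of the Ellis semigroup. -/
def IsMinimalIdempotent (e : X → X) : Prop :=
  e ∈ ellisKernel T X ∧ e ∘ e = e

/-- The (underlying set of the) structure group `H_e = e E e`. -/
def structureGroup (e : X → X) : Set (X → X) :=
  {h | ∃ g ∈ ellisSemigroup T X, h = e ∘ g ∘ e}

/-- The subgroup `K_e` of `H_e` of the elements which preserve every fibre of `π`. -/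
def fibrePreserving {Y : Type u} (π : X → Y) (e : X → X) : Set (X → X) :=
  {h | h ∈ structureGroup T e ∧ ∀ x, π (h x) = π x}

end EllisSemigroup

/-- The support of `f`: all `ξ` such that not every point of `e (π⁻¹(ξ))` is fixed by `f`. -/
def fibreSupport {X Y : Type u} (π : X → Y) (e f : X → X) : Set Y :=
  {ξ | ∃ x ∈ e '' (π ⁻¹' {ξ}), f x ≠ x}

section Factors

variable (T : Type v) [Group T]

/-- `(Z, T)` is equicontinuous: the maps `z ↦ t • z` form an equicontinuous family, with respect
to the unique uniform structure of the compact Hausdorff space `Z`. -/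
def IsEquicontinuousSystem (Z : Type u) [TopologicalSpace Z] [CompactSpace Z] [T2Space Z]
    [MulAction T Z] : Prop :=
  letI : UniformSpace Z := uniformSpaceOfCompactR1
  Equicontinuous fun (t : T) (z : Z) => t • z

/-- Factor maps of dynamical systems: continuous equivariant surjections. -/
structure IsFactorMap {X Y : Type u} [TopologicalSpace X] [TopologicalSpace Y]
    [MulAction T X] [MulAction T Y] (φ : X → Y) : Prop where
  continuous : Continuous φ
  surjective : Function.Surjective φ
  map_smul : ∀ (t : T) (x : X), φ (t • x) = t • φ x

/-- `π : X → Y` is the maximal equicontinuous factor of `(X, T)`: it is an equicontinuous factor,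
and every equicontinuous factor of `(X, T)` factors through it. (Every factor of `X` has a copy
in the universe of `X`.) -/
structure IsMaximalEquicontinuousFactor {X Y : Type u} [TopologicalSpace X] [MulAction T X]
    [TopologicalSpace Y] [CompactSpace Y] [T2Space Y] [MulAction T Y] (π : X → Y) : Prop where
  isFactorMap : IsFactorMap T π
  isEquicontinuous : IsEquicontinuousSystem T Y
  maximal : ∀ (Z : Type u) [TopologicalSpace Z] [CompactSpace Z] [T2Space Z] [MulAction T Z]
    (φ : X → Z), IsFactorMap T φ → IsEquicontinuousSystem T Z →
      ∃ ψ : Y → Z, IsFactorMap T ψ ∧ φ = ψ ∘ π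

end Factors

/-! Elements of `E` act on the factor by translations, and minimality realises every translation by
an element of `H_e`. Conjugating `f` by an element over `a` therefore gives a member of `K_e` with
support `supp f + a`. These supports are pairwise disjoint for `a ∈ A`, so for each `B ⊆ A` the
conjugates with index in `B` glue to one map. For finite `B` it is a product in `H_e`; in general it
is a pointwise limit of such products, eventually constant at each point because at most one index
matters there (`fibreGlue_mem_structureGroup`). Different `B` give different maps, hence `2 ^ #A`
elements. The upper bound counts self-maps of `X`, as `#X ≤ 𝔠`. -/

/-! ### Ellis semigroup, and the group property of `e E e` -/

section EllisSemigroupTheory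

variable {T : Type v} {X : Type u} [TopologicalSpace X] [Group T] [MulAction T X]

theorem isClosed_ellisSemigroup : IsClosed (ellisSemigroup T X) := isClosed_closure

theorem smul_mem_ellisSemigroup (t : T) : (fun x : X => t • x) ∈ ellisSemigroup T X :=
  subset_closure ⟨t, rfl⟩

theorem continuous_comp_right {α β γ : Type*} [TopologicalSpace γ] (g : α → β) :
    Continuous fun f : β → γ => f ∘ g :=
  continuous_pi fun x => continuous_apply (g x)

/-- Right composition with any map is continuous, left composition only with a continuous one. So
the closure is taken in `g` first, with a single `t` on the left, and then in `f`. -/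
theorem comp_mem_ellisSemigroup [ContinuousConstSMul T X] {f g : X → X}
    (hf : f ∈ ellisSemigroup T X) (hg : g ∈ ellisSemigroup T X) :
    f ∘ g ∈ ellisSemigroup T X := by
  have smul_comp : ∀ t : T, (fun x => t • x) ∘ g ∈ ellisSemigroup T X := by
    intro t
    have hc : Continuous fun k : X → X => (fun x => t • x) ∘ k :=
      continuous_pi fun x => (continuous_const_smul t).comp (continuous_apply x)
    refine closure_minimal ?_ (isClosed_ellisSemigroup.preimage hc) hg
    rintro _ ⟨s, rfl⟩
    refine subset_closure ⟨t * s, ?_⟩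
    funext x
    exact mul_smul t s x
  refine closure_minimal ?_
    (isClosed_ellisSemigroup.preimage (continuous_comp_right g)) hf
  rintro _ ⟨t, rfl⟩
  exact smul_comp t

/-- Non-empty closed left ideals of the Ellis semigroup. -/
structure IsClosedLeftIdeal (T : Type v) {X : Type u} [TopologicalSpace X] [Group T]
    [MulAction T X] (L : Set (X → X)) : Prop where
  subset : L ⊆ ellisSemigroup T X
  nonempty : L.Nonempty
  isClosed : IsClosed L
  comp_left : ∀ f ∈ ellisSemigroup T X, ∀ g ∈ L, f ∘ g ∈ L

theorem exists_mem_ellisSemigroup_apply_eq [CompactSpace X] [T2Space X] [MulAction.IsMinimal T X] (x y : X) :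
    ∃ g ∈ ellisSemigroup T X, g x = y := by
  have hclosed : IsClosed ((fun g : X → X => g x) '' ellisSemigroup T X) :=
    (isClosed_ellisSemigroup.isCompact.image (continuous_apply x)).isClosed
  have hsub : MulAction.orbit T x ⊆ (fun g : X → X => g x) '' ellisSemigroup T X := by
    rintro _ ⟨t, rfl⟩
    exact ⟨_, smul_mem_ellisSemigroup t, rfl⟩
  have := closure_minimal hsub hclosed
  rw [(MulAction.dense_orbit T x).closure_eq] at this
  exact this (mem_univ y)

variable [ContinuousConstSMul T X]

theorem mem_structureGroup_iff {e : X → X} (he : IsMinimalIdempotent T e) {h : X → X} :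
    h ∈ structureGroup T e ↔ h ∈ ellisSemigroup T X ∧ e ∘ h = h ∧ h ∘ e = h := by
  have heE : e ∈ ellisSemigroup T X := he.1.1
  constructor
  · rintro ⟨g, hg, rfl⟩
    refine ⟨comp_mem_ellisSemigroup heE (comp_mem_ellisSemigroup hg heE), ?_, ?_⟩
    · rw [← Function.comp_assoc, he.2]
    · rw [Function.comp_assoc, Function.comp_assoc, he.2]
  · rintro ⟨hE, h1, h2⟩
    exact ⟨h, hE, by rw [h2, h1]⟩

theorem comp_mem_structureGroup {e : X → X} (he : IsMinimalIdempotent T e) {g h : X → X}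
    (hg : g ∈ structureGroup T e) (hh : h ∈ structureGroup T e) :
    g ∘ h ∈ structureGroup T e := by
  rw [mem_structureGroup_iff he] at *
  refine ⟨comp_mem_ellisSemigroup hg.1 hh.1, ?_, ?_⟩
  · rw [← Function.comp_assoc, hg.2.1]
  · rw [Function.comp_assoc, hh.2.2]

theorem self_mem_structureGroup {e : X → X} (he : IsMinimalIdempotent T e) :
    e ∈ structureGroup T e :=
  (mem_structureGroup_iff he).2 ⟨he.1.1, he.2, he.2⟩

variable [CompactSpace X]

theorem exists_minimal_isClosedLeftIdeal :
    ∃ L : Set (X → X), Minimal (IsClosedLeftIdeal T) L := by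
  have hE : IsClosedLeftIdeal T (ellisSemigroup T X) :=
    ⟨Subset.rfl, ⟨_, smul_mem_ellisSemigroup 1⟩, isClosed_ellisSemigroup,
      fun f hf g hg => comp_mem_ellisSemigroup hf hg⟩
  obtain ⟨L, -, hL⟩ := zorn_superset_nonempty {L : Set (X → X) | IsClosedLeftIdeal T L}
    (fun c hc hchain hne => by
      refine ⟨⋂₀ c, ⟨?_, ?_, ?_, ?_⟩, fun s hs => sInter_subset_of_mem hs⟩
      · obtain ⟨L, hL⟩ := hne
        exact (sInter_subset_of_mem hL).trans (hc hL).subset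
      · have := hne.to_subtype
        exact IsCompact.nonempty_sInter_of_directed_nonempty_isCompact_isClosed
          (IsChain.directedOn hchain.symm) (fun L hL => (hc hL).nonempty)
          (fun L hL => (hc hL).isClosed.isCompact) (fun L hL => (hc hL).isClosed)
      · exact isClosed_sInter fun L hL => (hc hL).isClosed
      · exact fun f hf g hg L hL => (hc hL).comp_left f hf g (hg L hL))
    (ellisSemigroup T X) hE
  exact ⟨L, hL⟩

variable [T2Space X]

/-- `E ∘ l` is a continuous image of a compact set, hence a closed left ideal inside `L`, and
minimality makes it all of `L`. -/
theorem exists_comp_eq_of_minimal {L : Set (X → X)} (hL : Minimal (IsClosedLeftIdeal T) L)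
    {l m : X → X} (hl : l ∈ L) (hm : m ∈ L) : ∃ k ∈ ellisSemigroup T X, k ∘ l = m := by
  have hideal : IsClosedLeftIdeal T ((fun k : X → X => k ∘ l) '' ellisSemigroup T X) := by
    refine ⟨?_, ⟨_, mem_image_of_mem _ (smul_mem_ellisSemigroup 1)⟩, ?_, ?_⟩
    · rintro _ ⟨k, hk, rfl⟩
      exact comp_mem_ellisSemigroup hk (hL.prop.subset hl)
    · exact (isClosed_ellisSemigroup.isCompact.image (continuous_comp_right l)).isClosed
    · rintro f hf _ ⟨k, hk, rfl⟩
      exact ⟨f ∘ k, comp_mem_ellisSemigroup hf hk, rfl⟩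
  refine hL.le_of_le hideal ?_ hm
  rintro _ ⟨k, hk, rfl⟩
  exact hL.prop.comp_left k hk l hl

theorem exists_left_inverse_of_mem_structureGroup {e : X → X} (he : IsMinimalIdempotent T e)
    {h : X → X} (hh : h ∈ structureGroup T e) : ∃ k ∈ structureGroup T e, k ∘ h = e := by
  obtain ⟨hE, h1, h2⟩ := (mem_structureGroup_iff he).1 hh
  obtain ⟨L, hL⟩ := exists_minimal_isClosedLeftIdeal (T := T) (X := X)
  have hbil : IsBilateralIdeal T (image2 (fun l g : X → X => l ∘ g) L (ellisSemigroup T X)) := by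
    refine ⟨?_, hL.prop.nonempty.image2 ⟨_, smul_mem_ellisSemigroup 1⟩, ?_, ?_⟩
    · rintro _ ⟨l, hl, g, hg, rfl⟩
      exact comp_mem_ellisSemigroup (hL.prop.subset hl) hg
    · rintro f hf _ ⟨l, hl, g, hg, rfl⟩
      exact ⟨f ∘ l, hL.prop.comp_left f hf l hl, g, hg, rfl⟩
    · rintro f hf _ ⟨l, hl, g, hg, rfl⟩
      exact ⟨l, hl, g ∘ f, comp_mem_ellisSemigroup hg hf, rfl⟩
  -- The kernel lies in the bilateral ideal `L ∘ E`, so `e = l ∘ g`; undoing `h` on `l` then undoes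
  -- it on `e`.
  obtain ⟨l, hl, g, hg, hlg⟩ := he.1.2 _ hbil
  obtain ⟨k, hk, hkl⟩ := exists_comp_eq_of_minimal hL (hL.prop.comp_left h hE l hl) hl
  have hkh : k ∘ h = e := by
    calc k ∘ h = k ∘ h ∘ e := by rw [h2]
      _ = (k ∘ h ∘ l) ∘ g := by rw [← hlg]; rfl
      _ = e := by rw [hkl]; exact hlg
  refine ⟨e ∘ k ∘ e, ⟨k, hk, rfl⟩, ?_⟩
  calc (e ∘ k ∘ e) ∘ h = e ∘ k ∘ (e ∘ h) := rfl
    _ = e := by rw [h1, hkh, he.2]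

theorem exists_inverse_of_mem_structureGroup {e : X → X} (he : IsMinimalIdempotent T e)
    {h : X → X} (hh : h ∈ structureGroup T e) :
    ∃ k ∈ structureGroup T e, k ∘ h = e ∧ h ∘ k = e := by
  obtain ⟨k, hk, hkh⟩ := exists_left_inverse_of_mem_structureGroup he hh
  obtain ⟨m, hm, hmk⟩ := exists_left_inverse_of_mem_structureGroup he hk
  have hmh : m = h := by
    calc m = m ∘ (k ∘ h) := by rw [hkh, ((mem_structureGroup_iff he).1 hm).2.2]
      _ = (m ∘ k) ∘ h := rfl
      _ = h := by rw [hmk, ((mem_structureGroup_iff he).1 hh).2.1]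
  exact ⟨k, hk, hkh, hmh ▸ hmk⟩

end EllisSemigroupTheory

/-! ### Translations of the factor and of supports -/

section Translations

variable {T : Type v} {X Y : Type u} [TopologicalSpace X] [Group T] [MulAction T X]
  [TopologicalSpace Y] [T2Space Y] [AddCommGroup Y] [IsTopologicalAddGroup Y] [MulAction T Y]

/-- Elements of the Ellis semigroup act by translations on a factor on which `T` does. -/
theorem factor_sub_eq_of_mem_ellisSemigroup (htrans : ∀ (t : T) (ξ : Y), t • ξ = t • (0 : Y) + ξ)
    {π : X → Y} (hπ : IsFactorMap T π) {g : X → X} (hg : g ∈ ellisSemigroup T X) (x y : X) :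
    π (g x) - π x = π (g y) - π y := by
  have hclosed : IsClosed {g : X → X | π (g x) - π x = π (g y) - π y} :=
    isClosed_eq ((hπ.continuous.comp (continuous_apply x)).sub continuous_const)
      ((hπ.continuous.comp (continuous_apply y)).sub continuous_const)
  refine closure_minimal ?_ hclosed hg
  rintro _ ⟨t, rfl⟩
  change π (t • x) - π x = π (t • y) - π y
  rw [hπ.map_smul, hπ.map_smul, htrans t (π x), htrans t (π y), add_sub_cancel_right,
    add_sub_cancel_right]

theorem factor_apply_of_idempotent (htrans : ∀ (t : T) (ξ : Y), t • ξ = t • (0 : Y) + ξ)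
    {π : X → Y} (hπ : IsFactorMap T π) {e : X → X} (he : e ∈ ellisSemigroup T X)
    (hee : e ∘ e = e) (x : X) : π (e x) = π x := by
  have h := factor_sub_eq_of_mem_ellisSemigroup htrans hπ he x (e x)
  rw [show e (e x) = e x from congrFun hee x, sub_self] at h
  exact sub_eq_zero.1 h

variable [CompactSpace X] [T2Space X] [MulAction.IsMinimal T X]

theorem exists_mem_structureGroup_translation
    (htrans : ∀ (t : T) (ξ : Y), t • ξ = t • (0 : Y) + ξ)
    {π : X → Y} (hπ : IsFactorMap T π) {e : X → X} (he : IsMinimalIdempotent T e) (a : Y) :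
    ∃ h ∈ structureGroup T e, ∀ x, π (h x) = π x + a := by
  -- Any base point serves, since the displacement does not depend on the point.
  obtain ⟨x₀, -⟩ := hπ.surjective a
  obtain ⟨y, hy⟩ := hπ.surjective (π x₀ + a)
  obtain ⟨g, hg, hgx⟩ := exists_mem_ellisSemigroup_apply_eq (T := T) x₀ y
  have hπe := factor_apply_of_idempotent htrans hπ he.1.1 he.2
  refine ⟨e ∘ g ∘ e, ⟨g, hg, rfl⟩, fun x => ?_⟩
  have h := factor_sub_eq_of_mem_ellisSemigroup htrans hπ hg (e x) x₀
  rw [hgx, hy, hπe, add_sub_cancel_left] at h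
  change π (e (g (e x))) = _
  rw [hπe, sub_eq_iff_eq_add.1 h, add_comm]

/-- Conjugating `f` by an element which translates by `a` translates its support by `a`. -/
theorem exists_fibrePreserving_translated_support [ContinuousConstSMul T X]
    (htrans : ∀ (t : T) (ξ : Y), t • ξ = t • (0 : Y) + ξ)
    {π : X → Y} (hπ : IsFactorMap T π) {e : X → X} (he : IsMinimalIdempotent T e)
    {f : X → X} (hf : f ∈ fibrePreserving T π e) (a : Y) :
    ∃ k ∈ fibrePreserving T π e,
      fibreSupport π e k = (fun ξ => ξ + a) '' fibreSupport π e f := by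
  obtain ⟨h, hh, hπh⟩ := exists_mem_structureGroup_translation htrans hπ he a
  obtain ⟨k, hk, hkh, hhk⟩ := exists_inverse_of_mem_structureGroup he hh
  have hπe := factor_apply_of_idempotent htrans hπ he.1.1 he.2
  have hπk : ∀ x, π (k x) = π x - a := fun x => by
    have := hπh (k x)
    rw [show h (k x) = e x from congrFun hhk x, hπe] at this
    exact eq_sub_of_add_eq this.symm
  have hef : ∀ x, e (f x) = f x := congrFun ((mem_structureGroup_iff he).1 hf.1).2.1
  have hek : ∀ x, e (k x) = k x := congrFun ((mem_structureGroup_iff he).1 hk).2.1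
  have heh : ∀ x, e (h x) = h x := congrFun ((mem_structureGroup_iff he).1 hh).2.1
  have hee : ∀ x, e (e x) = e x := congrFun he.2
  have hkh' : ∀ x, k (h x) = e x := congrFun hkh
  have hhk' : ∀ x, h (k x) = e x := congrFun hhk
  refine ⟨h ∘ f ∘ k, ⟨comp_mem_structureGroup he hh (comp_mem_structureGroup he hf.1 hk),
    fun x => ?_⟩, ?_⟩
  · change π (h (f (k x))) = π x
    rw [hπh, hf.2, hπk, sub_add_cancel]
  · ext ξ
    constructor
    · rintro ⟨_, ⟨x, hx, rfl⟩, hne⟩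
      have hx : π x = ξ := hx
      refine ⟨ξ - a, ⟨k (e x), ⟨k (e x), ?_, hek _⟩, fun heq => hne ?_⟩, sub_add_cancel ξ a⟩
      · change π (k (e x)) = ξ - a
        rw [hπk, hπe, hx]
      · change h (f (k (e x))) = e x
        rw [heq, hhk', hee]
    · rintro ⟨η, ⟨_, ⟨x, hx, rfl⟩, hne⟩, rfl⟩
      have hx : π x = η := hx
      refine ⟨h (e x), ⟨h (e x), ?_, heh _⟩, fun heq => hne ?_⟩
      · change π (h (e x)) = η + a
        rw [hπh, hπe, hx]
      · have heq : h (f (k (h (e x)))) = h (e x) := heq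
        have := congrArg k heq
        rwa [hkh', hkh', hee, hef] at this

end Translations

/-! ### Gluing maps with disjoint supports -/

section Gluing

variable {T : Type v} {X Y : Type u}

open Classical in
/-- The map which agrees with `F a` over `S a` for `a ∈ B`, and with `e` elsewhere. -/
noncomputable def fibreGlue {ι : Type*} (π : X → Y) (e : X → X) (F : ι → X → X) (S : ι → Set Y)
    (B : Set ι) (x : X) : X :=
  if h : ∃ a ∈ B, π x ∈ S a then F h.choose x else e x

variable {ι : Type*} {π : X → Y} {e : X → X} {F : ι → X → X} {S : ι → Set Y}

theorem fibreGlue_of_mem (hS : ∀ a b ξ, ξ ∈ S a → ξ ∈ S b → a = b) {B : Set ι} {a : ι} {x : X}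
    (ha : a ∈ B) (hx : π x ∈ S a) : fibreGlue π e F S B x = F a x := by
  have h : ∃ a ∈ B, π x ∈ S a := ⟨a, ha, hx⟩
  rw [fibreGlue, dif_pos h, hS _ _ _ h.choose_spec.2 hx]

theorem fibreGlue_of_forall_notMem {B : Set ι} {x : X} (h : ∀ a ∈ B, π x ∉ S a) :
    fibreGlue π e F S B x = e x := by
  rw [fibreGlue, dif_neg]
  rintro ⟨a, ha, hx⟩
  exact h a ha hx

theorem fibreGlue_injective (hee : ∀ x, e (e x) = e x) (hπe : ∀ x, π (e x) = π x)
    (hS : ∀ a b ξ, ξ ∈ S a → ξ ∈ S b → a = b) (hFS : ∀ a, fibreSupport π e (F a) = S a)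
    (hne : ∀ a, (S a).Nonempty) : Function.Injective (fibreGlue π e F S) := by
  have hsub : ∀ B C : Set ι, fibreGlue π e F S B = fibreGlue π e F S C → B ⊆ C := by
    intro B C hBC a ha
    obtain ⟨ξ, hξ⟩ := hne a
    obtain ⟨_, ⟨x, hx, rfl⟩, hFx⟩ : ξ ∈ fibreSupport π e (F a) := hFS a ▸ hξ
    have hxS : π (e x) ∈ S a := by rwa [hπe, show π x = ξ from hx]
    by_contra haC
    -- For `a ∈ B \ C`, the map glued over `B` moves this point as `F a` does, while disjointness
    -- makes the one glued over `C` fix it.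
    have h := congrFun hBC (e x)
    rw [fibreGlue_of_mem hS ha hxS, fibreGlue_of_forall_notMem, hee] at h
    · exact hFx h
    · intro b hb hxb
      exact haC (hS _ _ _ hxS hxb ▸ hb)
  exact fun B C h => (hsub B C h).antisymm (hsub C B h.symm)

variable [TopologicalSpace X] [Group T] [MulAction T X]
  [ContinuousConstSMul T X]

/-- The glued map is the product of the `F a`, `a ∈ B`: each factor preserves fibres and fixes the
points of `e X` off its own support. -/
theorem fibreGlue_finset_mem_structureGroup (he : IsMinimalIdempotent T e)
    (hF : ∀ a, F a ∈ fibrePreserving T π e) (hπe : ∀ x, π (e x) = π x)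
    (hS : ∀ a b ξ, ξ ∈ S a → ξ ∈ S b → a = b) (hFS : ∀ a, fibreSupport π e (F a) = S a)
    (B : Finset ι) : fibreGlue π e F S (B : Set ι) ∈ structureGroup T e := by
  classical
  have hee : ∀ x, e (e x) = e x := congrFun he.2
  have heF : ∀ a x, e (F a x) = F a x := fun a =>
    congrFun ((mem_structureGroup_iff he).1 (hF a).1).2.1
  have hFe : ∀ a x, F a (e x) = F a x := fun a =>
    congrFun ((mem_structureGroup_iff he).1 (hF a).1).2.2
  have hfix : ∀ a x, e x = x → π x ∉ S a → F a x = x := by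
    intro a x hx hxS
    by_contra hne
    exact hxS (hFS a ▸ ⟨x, ⟨x, rfl, hx⟩, hne⟩)
  induction B using Finset.induction_on with
  | empty =>
    convert self_mem_structureGroup he
    funext x
    exact fibreGlue_of_forall_notMem (by simp)
  | insert a B haB ih =>
    convert comp_mem_structureGroup he (hF a).1 ih
    funext x
    rw [Function.comp_apply]
    by_cases hxa : π x ∈ S a
    · rw [fibreGlue_of_mem hS (by simp) hxa, fibreGlue_of_forall_notMem, hFe]
      intro b hb hxb
      exact haB (by simpa [hS _ _ _ hxa hxb] using hb)
    · by_cases hxB : ∃ b ∈ B, π x ∈ S b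
      · obtain ⟨b, hb, hxb⟩ := hxB
        rw [fibreGlue_of_mem hS (by simp [hb]) hxb, fibreGlue_of_mem hS (by simpa using hb) hxb,
          hfix a _ (heF b x)]
        rwa [(hF b).2]
      · push Not at hxB
        rw [fibreGlue_of_forall_notMem (by simpa [hxa] using hxB),
          fibreGlue_of_forall_notMem (by simpa using hxB), hfix a _ (hee x)]
        rwa [hπe]

theorem fibreGlue_mem_structureGroup (he : IsMinimalIdempotent T e)
    (hF : ∀ a, F a ∈ fibrePreserving T π e) (hπe : ∀ x, π (e x) = π x)
    (hS : ∀ a b ξ, ξ ∈ S a → ξ ∈ S b → a = b) (hFS : ∀ a, fibreSupport π e (F a) = S a)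
    (B : Set ι) : fibreGlue π e F S B ∈ structureGroup T e := by
  classical
  have hfin := fibreGlue_finset_mem_structureGroup he hF hπe hS hFS
  -- Once `C` contains the only index of `B` relevant to `x`, if there is one, the value no longer
  -- changes.
  have hev : ∀ x, ∀ᶠ C : Finset ι in Filter.atTop,
      fibreGlue π e F S (C.filter (· ∈ B) : Finset ι) x = fibreGlue π e F S B x := by
    intro x
    by_cases hx : ∃ a ∈ B, π x ∈ S a
    · obtain ⟨a, ha, hxa⟩ := hx
      filter_upwards [Filter.eventually_ge_atTop {a}] with C hC
      have haC : a ∈ C := hC (Finset.mem_singleton_self a)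
      rw [fibreGlue_of_mem hS ha hxa, fibreGlue_of_mem hS (by simp [haC, ha]) hxa]
    · push Not at hx
      refine Filter.Eventually.of_forall fun C => ?_
      rw [fibreGlue_of_forall_notMem hx, fibreGlue_of_forall_notMem]
      intro a ha
      exact hx a (Finset.mem_filter.1 ha).2
  refine (mem_structureGroup_iff he).2 ⟨?_, ?_, ?_⟩
  · refine isClosed_ellisSemigroup.mem_of_tendsto (b := Filter.atTop)
      (f := fun C : Finset ι => fibreGlue π e F S (C.filter (· ∈ B) : Finset ι))
      (tendsto_pi_nhds.2 fun x => ?_)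
      (Filter.Eventually.of_forall fun C => ((mem_structureGroup_iff he).1 (hfin _)).1)
    exact tendsto_const_nhds.congr' ((hev x).mono fun C hC => hC.symm)
  -- Left composition with `e` need not be continuous; eventual constancy replaces the passage to
  -- the limit.
  · funext x
    obtain ⟨C, hC⟩ := (hev x).exists
    rw [Function.comp_apply, ← hC]
    exact congrFun ((mem_structureGroup_iff he).1 (hfin _)).2.1 x
  · funext x
    obtain ⟨C, hC, hC'⟩ := ((hev x).and (hev (e x))).exists
    rw [Function.comp_apply, ← hC, ← hC']
    exact congrFun ((mem_structureGroup_iff he).1 (hfin _)).2.2 x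

end Gluing

/-! ### Cardinality bounds and the main theorem -/

theorem mk_le_continuum_of_secondCountable (X : Type u) [TopologicalSpace X] [T0Space X]
    [SecondCountableTopology X] : #X ≤ 𝔠 := by
  have hinj : Function.Injective fun x : X =>
      {U : TopologicalSpace.countableBasis X | x ∈ (U : Set X)} := by
    intro x y hxy
    refine ((TopologicalSpace.isBasis_countableBasis X).inseparable_iff.2 fun U hU => ?_).eq
    exact Set.ext_iff.1 hxy ⟨U, hU⟩
  calc #X ≤ #(Set (TopologicalSpace.countableBasis X)) := mk_le_of_injective hinj
    _ = 2 ^ #(TopologicalSpace.countableBasis X) := mk_set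
    _ ≤ 2 ^ (ℵ₀ : Cardinal.{u}) := power_le_power_left two_ne_zero
        (le_aleph0_iff_set_countable.2 (TopologicalSpace.countable_countableBasis X))
    _ = 𝔠 := two_power_aleph0

theorem mainTheorem2
    -- a minimal system `(X, T)`, `X` compact metrizable, `T` abelian
    {T : Type v} [CommGroup T]
    {X : Type u} [TopologicalSpace X] [CompactSpace X] [TopologicalSpace.MetrizableSpace X]
    [MulAction T X] [ContinuousConstSMul T X] [MulAction.IsMinimal T X]
    -- its maximal equicontinuous factor, with its structure of a compact abelian group on which
    -- `T` acts by translations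
    {Xmax : Type u} [TopologicalSpace Xmax] [CompactSpace Xmax] [T2Space Xmax]
    [AddCommGroup Xmax] [IsTopologicalAddGroup Xmax] [MulAction T Xmax]
    (htrans : ∀ (t : T) (ξ : Xmax), t • ξ = t • (0 : Xmax) + ξ)
    (π : X → Xmax) (hπ : IsMaximalEquicontinuousFactor T π)
    (e : X → X) (he : IsMinimalIdempotent T e)
    (f : X → X) (hf : f ∈ fibrePreserving T π e) (hfe : f ≠ e)
    (A : Set Xmax) (hA : ¬ A.Countable)
    (hdisj : ∀ a ∈ A, ∀ b ∈ A, a ≠ b →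
      ((fun ξ => ξ + a) '' fibreSupport π e f) ∩ ((fun ξ => ξ + b) '' fibreSupport π e f) = ∅) :
    2 ^ #A ≤ #(structureGroup T e) ∧
    #(structureGroup T e) ≤ 2 ^ (𝔠 : Cardinal.{u}) ∧
    (#A = (𝔠 : Cardinal.{u}) → #(structureGroup T e) = 2 ^ (𝔠 : Cardinal.{u})) ∧
    (ℵ₁ = (𝔠 : Cardinal.{u}) → #(structureGroup T e) = 2 ^ (𝔠 : Cardinal.{u})) := by
  have hfac := hπ.isFactorMap
  have hπe := factor_apply_of_idempotent htrans hfac he.1.1 he.2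
  have hX : #X ≤ (𝔠 : Cardinal.{u}) := by
    let _ := TopologicalSpace.metrizableSpaceMetric X
    exact mk_le_continuum_of_secondCountable X
  have lower : 2 ^ #A ≤ #(structureGroup T e) := by
    choose F hF hFS using fun a : A =>
      exists_fibrePreserving_translated_support htrans hfac he hf (a : Xmax)
    have hS : ∀ (a b : A) (ξ : Xmax), ξ ∈ (fun ξ => ξ + (a : Xmax)) '' fibreSupport π e f →
        ξ ∈ (fun ξ => ξ + (b : Xmax)) '' fibreSupport π e f → a = b := by
      intro a b ξ ha hb
      by_contra hab
      exact eq_empty_iff_forall_notMem.1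
        (hdisj a a.2 b b.2 fun h => hab (Subtype.ext h)) ξ ⟨ha, hb⟩
    have hne : (fibreSupport π e f).Nonempty := by
      obtain ⟨x, hx⟩ := Function.ne_iff.1 hfe
      -- Since `f ∘ e = f`, a point where `f` and `e` differ gives a point `e x` moved by `f`.
      refine ⟨π x, e x, ⟨x, rfl, rfl⟩, ?_⟩
      rwa [show f (e x) = f x from congrFun ((mem_structureGroup_iff he).1 hf.1).2.2 x]
    have hinj := fibreGlue_injective (e := e) (congrFun he.2) hπe hS hFS fun a => hne.image _
    rw [← mk_set]
    exact mk_le_of_injective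
      (f := fun B => (⟨_, fibreGlue_mem_structureGroup he hF hπe hS hFS B⟩ : structureGroup T e))
      fun B C h => hinj (Subtype.ext_iff.1 h)
  have upper : #(structureGroup T e) ≤ 2 ^ (𝔠 : Cardinal.{u}) := by
    calc #(structureGroup T e) ≤ #(X → X) := mk_set_le _
      _ = #X ^ #X := by simp
      _ ≤ 𝔠 ^ (𝔠 : Cardinal.{u}) :=
        (power_le_power_right hX).trans (power_le_power_left continuum_ne_zero hX)
      _ = 2 ^ (𝔠 : Cardinal.{u}) := power_self_eq aleph0_le_continuum
  have eq_of_mk : #A = (𝔠 : Cardinal.{u}) → #(structureGroup T e) = 2 ^ (𝔠 : Cardinal.{u}) :=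
    fun h => upper.antisymm (h ▸ lower)
  refine ⟨lower, upper, eq_of_mk, fun hCH => eq_of_mk (le_antisymm ?_ ?_)⟩
  -- `A` lies in a quotient of `X`, so `#A ≤ 𝔠`; uncountability gives `ℵ₁ ≤ #A`.
  · exact (mk_set_le A).trans ((mk_le_of_surjective hfac.surjective).trans hX)
  · rw [← hCH]
    by_contra h
    exact hA (le_aleph0_iff_set_countable.1 (lt_aleph_one_iff.1 (not_le.1 h)))
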